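/- **Theorem 1.3 (with its integer-valued form, Theorem 6.3).** Write $[n]=\{0,1,\dots,n-1\}\subset\mathbb R$. A function $f\colon[n]\to\mathbb R$ is *convex* if $f\bigl(\sum_i\lambda_i x_i\bigr)\le\sum_i\lambda_i f(x_i)$ for all finitely many $x_i\in[n]$ and reals $\lambda_i\ge 0$ with $\sum_i\lambda_i=1$ and $\sum_i\lambda_i x_i\in[n]$. It is *$\varepsilon$-far from convex* if $|\{x\in[n]: h(x)\ne f(x)\}|\ge\varepsilon n$ for every convex $h\colon[n]\to\mathbb R$. For $V\subseteq\mathbb R$ and $0<\delta<\tfrac12$, an *$\varepsilon$-tester with error $\delta$ for convexity of functions $[n]\to V$* is a randomized algorithm that queries values of an unknown function $f\colon[n]\to V$, where each query may depend on the internal randomness and on the previous answers (adaptive; non-adaptive algorithms are a special case), and that accepts with probability at least $1-\delta$ if $f$ is convex and rejects with probability at least $1-\delta$ if $f$ is $\varepsilon$-far from convex. Its query complexity is the maximal number of queries over all inputs $f\colon[n]\to V$ and all outcomes of its randomness. For every $0<\delta<\tfrac12$ there is a constant $c>0$, depending only on $\delta$, such that for every integer $n\ge1$ and every real $\varepsilon$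 with $\frac1n\le\varepsilon\le\frac19$, every $\varepsilon$-tester with error $\delta$ for convexity of functions $[n]\to\mathbb R$ has query complexity at least $c\,\frac{\log(\varepsilon n)}{\varepsilon}$. The same bound holds for every $\varepsilon$-tester with error $\delta$ for convexity of functions $[n]\to\mathbb Z$ (farness still being measured against all convex $h\colon[n]\to\mathbb R$). -/

import Mathlib

universe u

/-- A function `f` on the line `[n] = {0, 1, …, n-1} ⊆ ℝ` is convex if
`f (∑ wᵢ xᵢ) ≤ ∑ wᵢ f (xᵢ)` for every finite collection of points `xᵢ` of `[n]` and all weights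
`wᵢ ≥ 0` with `∑ wᵢ = 1` such that `∑ wᵢ xᵢ` is again a point of `[n]`. -/
def LineConvex {n : ℕ} (f : Fin n → ℝ) : Prop :=
  ∀ (k : ℕ) (x : Fin k → Fin n) (w : Fin k → ℝ) (z : Fin n),
    (∀ i, 0 ≤ w i) → ∑ i, w i = 1 → ∑ i, w i * ((x i : ℕ) : ℝ) = ((z : ℕ) : ℝ) →
      f z ≤ ∑ i, w i * f (x i)

/-- `g` is `ε`-far from convex: every convex real-valued function on `[n]` differs from `g` in at
least `ε n` points. -/
def FarFromConvex {n : ℕ} (ε : ℝ) (g : Fin n → ℝ) : Prop :=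
  ∀ h : Fin n → ℝ, LineConvex h →
    ε * (n : ℝ) ≤ ((Finset.univ.filter (fun x : Fin n => h x ≠ g x)).card : ℝ)

/-- Deterministic (adaptive) query algorithms for an unknown function `f : X → ℝ`: either stop with
an answer (`true` = accept, `false` = reject), or query a point `x` and continue in a way that may
depend on the value `f x`. -/
inductive DecisionTree (X : Type) : Type where
  | leaf (answer : Bool) : DecisionTree X
  | query (x : X) (next : ℝ → DecisionTree X) : DecisionTree X

/-- The answer of the decision tree on the input `f`. -/
def DecisionTree.output {X : Type} (f : X → ℝ) : DecisionTree X → Bool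
  | .leaf b => b
  | .query x next => (next (f x)).output f

/-- The number of queries made by the decision tree on the input `f`. -/
def DecisionTree.numQueries {X : Type} (f : X → ℝ) : DecisionTree X → ℕ
  | .leaf _ => 0
  | .query x next => (next (f x)).numQueries f + 1

/-- A randomized query algorithm: a random decision tree, i.e. a probability space of internal
coin tosses and a decision tree for each outcome. Acceptance of any fixed input is an event. -/
structure RandomizedQueryAlgorithm (X : Type) where
  /-- outcomes of the internal coin tosses -/
  Ω : Type u
  [mΩ : MeasurableSpace Ω]
  μ : MeasureTheory.Measure Ω
  [isProb : MeasureTheory.IsProbabilityMeasure μ]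
  tree : Ω → DecisionTree X
  measurableSet_accept : ∀ f : X → ℝ, MeasurableSet {ω | (tree ω).output f = true}

attribute [instance] RandomizedQueryAlgorithm.mΩ RandomizedQueryAlgorithm.isProb

namespace RandomizedQueryAlgorithm

/-- The probability that the algorithm answers `b` on the input `f`. -/
noncomputable def probOutput {X : Type} (T : RandomizedQueryAlgorithm.{u} X) (f : X → ℝ)
    (b : Bool) : ℝ :=
  T.μ.real {ω | (T.tree ω).output f = b}

/-- `T` is an `ε`-tester with error probability at most `δ` for convexity of functions `[n] → V`,
where `V ⊆ ℝ`. No behaviour is required on the functions that are neither convex nor `ε`-far. -/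
def IsConvexityTester {n : ℕ} (T : RandomizedQueryAlgorithm.{u} (Fin n)) (V : Set ℝ)
    (ε δ : ℝ) : Prop :=
  ∀ f : Fin n → ℝ, (∀ x, f x ∈ V) →
    (LineConvex f → 1 - δ ≤ T.probOutput f true) ∧
    (FarFromConvex ε f → 1 - δ ≤ T.probOutput f false)

/-- On inputs `[n] → V`, the worst-case query complexity of `T` is at most `q`. -/
def QueryComplexityLE {n : ℕ} (T : RandomizedQueryAlgorithm.{u} (Fin n)) (V : Set ℝ)
    (q : ℕ) : Prop :=
  ∀ f : Fin n → ℝ, (∀ x, f x ∈ V) → ∀ ω, (T.tree ω).numQueries f ≤ q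

end RandomizedQueryAlgorithm

/-! Fix dyadic blocks of length `2 ^ K` with `2 ^ K` of order `ε n`. The convex inputs are the
functions whose second differences `a i` range independently over `[0, N i)`, where `N i = W ^
boundaryLevel K i` and `W` is huge. For a pair `p = (j, k)`, the far inputs come from adding `bend`,
which tilts by slope `-C`, with `C = n * W ^ k`, the right half of every dyadic interval of length
`2 ^ (k + 1)` in block `j`.

The scales are separated. Away from the first two points of such an interval, second differences are
below `W ^ k`, so slopes of the convex part vary by less than `C` inside it, and the tilt destroys
convexity on about a quarter of the block (`farFromConvex_bend`). At the first two points, second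
differences range up to at least `W ^ (k + 1)`, which dwarfs the correction, of size at most `4 * C
* n`, that hides the tilt. If no interval has queries in both halves, one can replace the tilt by a
function that agrees with it on the queries and is affine on each interval, and absorb this function
into `a` (`card_accept_le`). Widening the box to make room costs a factor at most `1 / (2 * δ)`
(`card_integerBox_le`).

So a tester can detect the pair `p` only when its queries split `p`, and a set of `q` points splits
at most `q` pairs (`card_filter_splits_le`). Averaging over inputs and coin tosses gives `q ≥ (1/2 -
δ) * |I|`, with about `1 / ε` blocks times `log (ε n)` scales in `I`. All inputs are integer-valued,
so both forms of the theorem follow together. -/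

namespace DecisionTree

/-- The set of points queried by the decision tree on the input `f`. -/
def queried {X : Type} [DecidableEq X] (f : X → ℝ) : DecisionTree X → Finset X
  | .leaf _ => ∅
  | .query x next => insert x ((next (f x)).queried f)

theorem card_queried_le {X : Type} [DecidableEq X] (f : X → ℝ) (t : DecisionTree X) :
    (t.queried f).card ≤ t.numQueries f := by
  induction t with
  | leaf b => simp [queried, numQueries]
  | query x next ih =>
    exact (Finset.card_insert_le _ _).trans (Nat.add_le_add_right (ih _) 1)

/-- Adaptivity does no harm: equal answers along the path taken on `f` force the same path on `g`.
-/
theorem queried_output_congr {X : Type} [DecidableEq X] {f g : X → ℝ} (t : DecisionTree X)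
    (hfg : ∀ x ∈ t.queried f, g x = f x) :
    t.queried g = t.queried f ∧ t.output g = t.output f := by
  induction t with
  | leaf b => exact ⟨rfl, rfl⟩
  | query x next ih =>
    have hx : g x = f x := hfg x (Finset.mem_insert_self _ _)
    have := ih (f x) fun y hy => hfg y (Finset.mem_insert_of_mem hy)
    simp only [queried, output, hx]
    exact ⟨by rw [this.1], this.2⟩

end DecisionTree

/-! ### Slopes of convex functions and distance to convexity. -/

section Convexity

theorem LineConvex.three_points {n : ℕ} {f : Fin n → ℝ} (hf : LineConvex f) {x y z : Fin n}
    (hxy : x < y) (hyz : y < z) :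
    (f y - f x) * ((z : ℕ) - (y : ℕ) : ℝ) ≤ (f z - f y) * ((y : ℕ) - (x : ℕ) : ℝ) := by
  have h1 : ((x : ℕ) : ℝ) < (y : ℕ) := by exact_mod_cast hxy
  have h2 : ((y : ℕ) : ℝ) < (z : ℕ) := by exact_mod_cast hyz
  have h3 : (0 : ℝ) < (z : ℕ) - (x : ℕ) := by linarith
  have key := hf 2 ![x, z]
    ![((z : ℕ) - (y : ℕ) : ℝ) / ((z : ℕ) - (x : ℕ)), ((y : ℕ) - (x : ℕ) : ℝ) / ((z : ℕ) - (x : ℕ))] y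
    (by
      intro i
      fin_cases i
      · exact div_nonneg (by linarith) h3.le
      · exact div_nonneg (by linarith) h3.le)
    (by simp only [Fin.sum_univ_two, Matrix.cons_val_zero, Matrix.cons_val_one]; field_simp; ring)
    (by simp only [Fin.sum_univ_two, Matrix.cons_val_zero, Matrix.cons_val_one]; field_simp; ring)
  simp only [Fin.sum_univ_two, Matrix.cons_val_zero, Matrix.cons_val_one] at key
  rw [div_mul_eq_mul_div, div_mul_eq_mul_div, ← add_div, le_div_iff₀ h3] at key
  linarith

/-- The two slopes are compared through that of the middle chord from `x'` to `y`. -/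
theorem LineConvex.four_points {n : ℕ} {f : Fin n → ℝ} (hf : LineConvex f) {x x' y y' : Fin n}
    (hx : x < x') (hxy : x' < y) (hy : y < y') :
    (f x' - f x) * ((y' : ℕ) - (y : ℕ) : ℝ) ≤ (f y' - f y) * ((x' : ℕ) - (x : ℕ) : ℝ) := by
  have h1 : (0 : ℝ) < (x' : ℕ) - (x : ℕ) := sub_pos.2 (by exact_mod_cast hx)
  have h2 : (0 : ℝ) < (y : ℕ) - (x' : ℕ) := sub_pos.2 (by exact_mod_cast hxy)
  have h3 : (0 : ℝ) < (y' : ℕ) - (y : ℕ) := sub_pos.2 (by exact_mod_cast hy)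
  have k1 := mul_le_mul_of_nonneg_right (hf.three_points hx hxy) h3.le
  have k2 := mul_le_mul_of_nonneg_right (hf.three_points hxy hy) h1.le
  refine le_of_mul_le_mul_right ?_ h2
  linarith

theorem card_filter_fin_interval {n s d : ℕ} (h : s + d ≤ n) :
    (Finset.univ.filter (fun x : Fin n => s ≤ (x : ℕ) ∧ (x : ℕ) < s + d)).card = d := by
  have : (Finset.univ.filter (fun x : Fin n => s ≤ (x : ℕ) ∧ (x : ℕ) < s + d)).image Fin.val
      = Finset.Ico s (s + d) := by
    ext y
    simp only [Finset.mem_image, Finset.mem_filter, Finset.mem_univ, true_and, Finset.mem_Ico]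
    constructor
    · rintro ⟨x, hx, rfl⟩
      exact hx
    · intro hy
      exact ⟨⟨y, by omega⟩, hy, rfl⟩
  rw [← Finset.card_image_of_injective _ Fin.val_injective, this]
  simp

/-- Either two distinct points of an interval of length `d` are outside of a set, or at least
`d - 1` points of the interval are in the set. -/
theorem exists_lt_or_le_card {n s d : ℕ} (h : s + d ≤ n) (p : Fin n → Prop) [DecidablePred p] :
    (∃ x y : Fin n, s ≤ (x : ℕ) ∧ x < y ∧ (y : ℕ) < s + d ∧ ¬ p x ∧ ¬ p y) ∨
      d - 1 ≤ (Finset.univ.filter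
        (fun x : Fin n => p x ∧ s ≤ (x : ℕ) ∧ (x : ℕ) < s + d)).card := by
  have hc := Finset.card_filter_add_card_filter_not
    (s := Finset.univ.filter (fun x : Fin n => s ≤ (x : ℕ) ∧ (x : ℕ) < s + d)) p
  rw [card_filter_fin_interval h, Finset.filter_filter, Finset.filter_filter] at hc
  by_cases h1 : 1 < (Finset.univ.filter
      (fun x : Fin n => (s ≤ (x : ℕ) ∧ (x : ℕ) < s + d) ∧ ¬ p x)).card
  · left
    obtain ⟨x, hx, y, hy, hne⟩ := Finset.one_lt_card.1 h1
    simp only [Finset.mem_filter, Finset.mem_univ, true_and] at hx hy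
    rcases lt_or_gt_of_ne hne with hlt | hlt
    · exact ⟨x, y, hx.1.1, hlt, hy.1.2, hx.2, hy.2⟩
    · exact ⟨y, x, hy.1.1, hlt, hx.1.2, hy.2, hx.2⟩
  · right
    have : (Finset.univ.filter (fun x : Fin n => p x ∧ s ≤ (x : ℕ) ∧ (x : ℕ) < s + d))
        = (Finset.univ.filter (fun x : Fin n => (s ≤ (x : ℕ) ∧ (x : ℕ) < s + d) ∧ p x)) := by
      ext x; simp [and_comm]
    rw [this]
    omega

/-- If all slopes of `g` on the left half of an interval exceed all slopes on the right half, then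
every convex function differs from `g` in almost half of the interval. -/
theorem le_card_ne_of_slopes {n s d : ℕ} (hn : s + 2 * d ≤ n) {f g : Fin n → ℝ}
    (hf : LineConvex f) (P : ℝ)
    (hleft : ∀ x y : Fin n, s ≤ (x : ℕ) → x < y → (y : ℕ) < s + d →
      P * ((y : ℕ) - (x : ℕ) : ℝ) ≤ g y - g x)
    (hright : ∀ x y : Fin n, s + d ≤ (x : ℕ) → x < y → (y : ℕ) < s + 2 * d →
      g y - g x < P * ((y : ℕ) - (x : ℕ) : ℝ)) :
    d - 1 ≤ (Finset.univ.filter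
      (fun x : Fin n => f x ≠ g x ∧ s ≤ (x : ℕ) ∧ (x : ℕ) < s + 2 * d)).card := by
  rcases exists_lt_or_le_card (show s + d ≤ n by omega) (fun x => f x ≠ g x) with
    ⟨x, x', hx, hxx, hx', e1, e2⟩ | h
  · rcases exists_lt_or_le_card (show (s + d) + d ≤ n by omega) (fun x => f x ≠ g x) with
      ⟨y, y', hy, hyy, hy', e3, e4⟩ | h
    -- Two agreement points in each half would give the convex `f` a larger slope on the left than
    -- on the right; hence some half has at most one agreement point.
    · exfalso
      rw [not_not] at e1 e2 e3 e4
      have h4 := hf.four_points hxx (show x' < y from Fin.lt_def.2 (by omega)) hyy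
      rw [e1, e2, e3, e4] at h4
      have h1 : (0 : ℝ) < (x' : ℕ) - (x : ℕ) := sub_pos.2 (by exact_mod_cast hxx)
      have h3 : (0 : ℝ) < (y' : ℕ) - (y : ℕ) := sub_pos.2 (by exact_mod_cast hyy)
      have k1 := mul_le_mul_of_nonneg_right (hleft x x' hx hxx hx') h3.le
      have k2 := mul_lt_mul_of_pos_right (hright y y' hy hyy (by omega)) h1
      linarith
    · refine h.trans (Finset.card_le_card fun x hx => ?_)
      simp only [Finset.mem_filter, Finset.mem_univ, true_and] at hx ⊢
      exact ⟨hx.1, by omega, by omega⟩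
  · refine h.trans (Finset.card_le_card fun x hx => ?_)
    simp only [Finset.mem_filter, Finset.mem_univ, true_and] at hx ⊢
    exact ⟨hx.1, by omega, by omega⟩

end Convexity

/-! ### Integer functions parametrized by their second differences. -/

section RampSum

/-- The function on `[n]` whose second differences are the entries of `a`. -/
def rampSum {n : ℕ} (a : Fin n → ℤ) (x : Fin n) : ℤ :=
  ∑ i : Fin n, a i * (((x : ℕ) + 1 - (i : ℕ) : ℕ) : ℤ)

theorem rampSum_sub {n : ℕ} (a b : Fin n → ℤ) (x : Fin n) :
    rampSum (a - b) x = rampSum a x - rampSum b x := by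
  simp [rampSum, sub_mul, Finset.sum_sub_distrib]

/-- Each ramp is the maximum of an affine function and `0`, hence convex, and nonnegative
combinations preserve convexity. -/
theorem lineConvex_rampSum {n : ℕ} {a : Fin n → ℤ} (ha : ∀ i, 0 ≤ a i) :
    LineConvex (fun x => (rampSum a x : ℝ)) := by
  intro k x w z hw hw1 hz
  have hramp : ∀ y i : Fin n, (((((y : ℕ) + 1 - (i : ℕ) : ℕ) : ℤ)) : ℝ)
      = max (((y : ℕ) : ℝ) + 1 - (i : ℕ)) 0 := by
    intro y i
    rcases le_total (i : ℕ) ((y : ℕ) + 1) with h | h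
    · have h' : ((i : ℕ) : ℝ) ≤ (y : ℕ) + 1 := by exact_mod_cast h
      rw [max_eq_left (by linarith)]
      push_cast [Nat.cast_sub h]
      ring
    · have h' : ((y : ℕ) : ℝ) + 1 ≤ (i : ℕ) := by exact_mod_cast h
      rw [max_eq_right (by linarith), Nat.sub_eq_zero_of_le h]
      simp
  simp only [rampSum, Int.cast_sum, Int.cast_mul, hramp, Finset.mul_sum]
  rw [Finset.sum_comm]
  refine Finset.sum_le_sum fun i _ => ?_
  have hai : (0 : ℝ) ≤ a i := by exact_mod_cast ha i
  have : max (((z : ℕ) : ℝ) + 1 - (i : ℕ)) 0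
      ≤ ∑ l, w l * max (((x l : ℕ) : ℝ) + 1 - (i : ℕ)) 0 := by
    refine max_le ?_ (Finset.sum_nonneg fun l _ => mul_nonneg (hw l) (le_max_right _ _))
    have e : ((z : ℕ) : ℝ) + 1 - (i : ℕ) = ∑ l, w l * (((x l : ℕ) : ℝ) + 1 - (i : ℕ)) := by
      simp only [mul_sub, mul_add, Finset.sum_sub_distrib, Finset.sum_add_distrib, hz,
        ← Finset.sum_mul, hw1, one_mul]
    rw [e]
    exact Finset.sum_le_sum fun l _ => mul_le_mul_of_nonneg_left (le_max_left _ _) (hw l)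
  calc _ ≤ (a i : ℝ) * ∑ l, w l * max (((x l : ℕ) : ℝ) + 1 - (i : ℕ)) 0 :=
        mul_le_mul_of_nonneg_left this hai
    _ = _ := by
        rw [Finset.mul_sum]
        exact Finset.sum_congr rfl fun l _ => by ring

/-- The ramps starting at or before `s + 1` are affine on the interval and contribute the common
initial slope; those starting inside add between `0` and `B` each; later ones vanish there. -/
theorem rampSum_slope_bounds {n s e : ℕ} {a : Fin n → ℤ} {B : ℤ} (hB : 0 ≤ B)
    (ha : ∀ i : Fin n, s + 2 ≤ (i : ℕ) → (i : ℕ) < s + e → 0 ≤ a i ∧ a i ≤ B)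
    {x y : Fin n} (hx : s ≤ (x : ℕ)) (hxy : x < y) (hy : (y : ℕ) < s + e) :
    (∑ i : Fin n, if (i : ℕ) ≤ s + 1 then a i else 0) * ((y : ℕ) - (x : ℕ) : ℤ)
        ≤ rampSum a y - rampSum a x ∧
      rampSum a y - rampSum a x
        ≤ ((∑ i : Fin n, if (i : ℕ) ≤ s + 1 then a i else 0) + n * B)
          * ((y : ℕ) - (x : ℕ) : ℤ) := by
  have hxy' : (x : ℕ) < (y : ℕ) := hxy
  have hd : (0 : ℤ) ≤ (y : ℕ) - (x : ℕ) := by omega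
  have hdiff : rampSum a y - rampSum a x = ∑ i : Fin n,
      a i * ((((y : ℕ) + 1 - (i : ℕ) : ℕ) : ℤ) - (((x : ℕ) + 1 - (i : ℕ) : ℕ) : ℤ)) := by
    simp [rampSum, mul_sub, Finset.sum_sub_distrib]
  have hterm : ∀ i : Fin n,
      (if (i : ℕ) ≤ s + 1 then a i else 0) * ((y : ℕ) - (x : ℕ) : ℤ) ≤
        a i * ((((y : ℕ) + 1 - (i : ℕ) : ℕ) : ℤ) - (((x : ℕ) + 1 - (i : ℕ) : ℕ) : ℤ)) ∧
      a i * ((((y : ℕ) + 1 - (i : ℕ) : ℕ) : ℤ) - (((x : ℕ) + 1 - (i : ℕ) : ℕ) : ℤ)) ≤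
        ((if (i : ℕ) ≤ s + 1 then a i else 0) + B) * ((y : ℕ) - (x : ℕ) : ℤ) := by
    intro i
    have hBd := mul_nonneg hB hd
    by_cases h1 : (i : ℕ) ≤ s + 1
    · have e1 : ((((y : ℕ) + 1 - (i : ℕ) : ℕ) : ℤ) - (((x : ℕ) + 1 - (i : ℕ) : ℕ) : ℤ))
          = (y : ℕ) - (x : ℕ) := by omega
      rw [if_pos h1, e1]
      exact ⟨le_rfl, by linarith⟩
    · rw [if_neg h1, zero_mul, zero_add]
      by_cases h2 : (i : ℕ) < s + e
      · obtain ⟨h3, h4⟩ := ha i (by omega) h2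
        have h5 : (0 : ℤ) ≤
          (((y : ℕ) + 1 - (i : ℕ) : ℕ) : ℤ) - (((x : ℕ) + 1 - (i : ℕ) : ℕ) : ℤ) := by omega
        have h6 : (((y : ℕ) + 1 - (i : ℕ) : ℕ) : ℤ) - (((x : ℕ) + 1 - (i : ℕ) : ℕ) : ℤ)
          ≤ (y : ℕ) - (x : ℕ) := by omega
        exact ⟨mul_nonneg h3 h5, mul_le_mul h4 h6 h5 hB⟩
      · have e1 : ((((y : ℕ) + 1 - (i : ℕ) : ℕ) : ℤ) - (((x : ℕ) + 1 - (i : ℕ) : ℕ) : ℤ))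
          = 0 := by omega
        rw [e1, mul_zero]
        exact ⟨le_rfl, hBd⟩
  constructor
  · rw [hdiff, Finset.sum_mul]
    exact Finset.sum_le_sum fun i _ => (hterm i).1
  · have : (∑ i : Fin n, if (i : ℕ) ≤ s + 1 then a i else 0) + n * B
        = ∑ i : Fin n, ((if (i : ℕ) ≤ s + 1 then a i else 0) + B) := by
      simp [Finset.sum_add_distrib]
    rw [hdiff, this, Finset.sum_mul]
    exact Finset.sum_le_sum fun i _ => (hterm i).2

/-- Second differences of a sequence, extended by `0` to the left of the origin. -/
def secondDiff (H : ℕ → ℤ) : ℕ → ℤ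
  | 0 => H 0
  | 1 => H 1 - 2 * H 0
  | i + 2 => H (i + 2) - 2 * H (i + 1) + H i

theorem sum_secondDiff (H : ℕ → ℤ) (m : ℕ) :
    ∑ i ∈ Finset.range (m + 2), secondDiff H i = H (m + 1) - H m := by
  induction m with
  | zero => simp [Finset.sum_range_succ, secondDiff]; ring
  | succ m ih =>
    rw [Finset.sum_range_succ, ih, secondDiff]
    ring

theorem sum_secondDiff_mul (H : ℕ → ℤ) (m : ℕ) :
    ∑ i ∈ Finset.range (m + 1), secondDiff H i * ((m + 1 - i : ℕ) : ℤ) = H m := by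
  induction m with
  | zero => simp [secondDiff]
  | succ m ih =>
    have h1 : ∑ i ∈ Finset.range (m + 2), secondDiff H i * ((m + 2 - i : ℕ) : ℤ)
        = ∑ i ∈ Finset.range (m + 2), secondDiff H i * ((m + 1 - i : ℕ) : ℤ)
          + ∑ i ∈ Finset.range (m + 2), secondDiff H i := by
      rw [← Finset.sum_add_distrib]
      refine Finset.sum_congr rfl fun i hi => ?_
      have : ((m + 2 - i : ℕ) : ℤ) = ((m + 1 - i : ℕ) : ℤ) + 1 := by
        have := Finset.mem_range.1 hi
        omega
      rw [this]
      ring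
    rw [h1, sum_secondDiff, Finset.sum_range_succ, ih]
    simp

theorem rampSum_secondDiff {n : ℕ} (H : ℕ → ℤ) (x : Fin n) :
    rampSum (fun i : Fin n => secondDiff H i) x = H x := by
  rw [rampSum, Fin.sum_univ_eq_sum_range
    (fun i => secondDiff H i * (((x : ℕ) + 1 - i : ℕ) : ℤ)) n, ← sum_secondDiff_mul H x]
  symm
  refine Finset.sum_subset (Finset.range_subset_range.2 x.2) fun i _ hi => ?_
  rw [Finset.mem_range, not_lt] at hi
  rw [Nat.sub_eq_zero_of_le hi]
  simp

theorem abs_secondDiff_le {H : ℕ → ℤ} {n : ℕ} {D : ℤ} (hH : ∀ x < n, |H x| ≤ D) {i : ℕ}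
    (hi : i < n) : |secondDiff H i| ≤ 4 * D := by
  have key : ∀ x < n, -D ≤ H x ∧ H x ≤ D := fun x hx => abs_le.1 (hH x hx)
  rw [abs_le]
  match i, hi with
  | 0, hi => have := key 0 hi; simp only [secondDiff]; omega
  | 1, hi => have := key 1 hi; have := key 0 (by omega); simp only [secondDiff]; omega
  | i + 2, hi =>
    have := key (i + 2) hi
    have := key (i + 1) (by omega)
    have := key i (by omega)
    simp only [secondDiff]
    omega

end RampSum

/-! ### Dyadic scales and the pairs split by a query set. -/

section Dyadic

theorem div_two_pow_eq_of_le {a b r s : ℕ} (hrs : r ≤ s) (h : a / 2 ^ r = b / 2 ^ r) :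
    a / 2 ^ s = b / 2 ^ s := by
  obtain ⟨t, rfl⟩ := Nat.exists_eq_add_of_le hrs
  rw [pow_add, ← Nat.div_div_eq_div_mul, ← Nat.div_div_eq_div_mul, h]

/-- Some dyadic interval of length `2 ^ (p.2 + 1)` inside the `p.1`-th dyadic interval of length
`2 ^ K` has points of `Q` in both of its halves. -/
def Splits {n : ℕ} (Q : Finset (Fin n)) (K : ℕ) (p : ℕ × ℕ) : Prop :=
  ∃ x ∈ Q, ∃ y ∈ Q, (x : ℕ) / 2 ^ K = p.1 ∧ (x : ℕ) / 2 ^ (p.2 + 1) = (y : ℕ) / 2 ^ (p.2 + 1) ∧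
    Even ((x : ℕ) / 2 ^ p.2) ∧ Odd ((y : ℕ) / 2 ^ p.2)

-- Charge a split pair to the last point `z` of `Q` in the left half of a split interval. Its
-- successor in `Q` lies in the right half of the same interval, so consecutive points of `Q` are
-- separated at exactly the scale in question.
open Classical in
theorem card_filter_splits_le {n : ℕ} (Q : Finset (Fin n)) (K : ℕ) (I : Finset (ℕ × ℕ))
    (hI : ∀ p ∈ I, p.2 + 1 ≤ K) : (I.filter (Splits Q K)).card ≤ Q.card := by
  refine Finset.card_le_card_of_forall_subsingleton
    (fun p (z : Fin n) => (z : ℕ) / 2 ^ K = p.1 ∧ ∃ z' ∈ Q, z < z' ∧ (∀ w ∈ Q, z < w → z' ≤ w) ∧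
      (z : ℕ) / 2 ^ p.2 ≠ (z' : ℕ) / 2 ^ p.2 ∧
      (z : ℕ) / 2 ^ (p.2 + 1) = (z' : ℕ) / 2 ^ (p.2 + 1)) ?_ ?_
  · intro p hp
    obtain ⟨hpI, x, hx, y, hy, hxj, hxy, hxe, hyo⟩ := Finset.mem_filter.1 hp
    have hxy2 : (x : ℕ) / 2 ^ p.2 < (y : ℕ) / 2 ^ p.2 := by
      rw [pow_succ, ← Nat.div_div_eq_div_mul, ← Nat.div_div_eq_div_mul] at hxy
      rw [Nat.even_iff] at hxe
      rw [Nat.odd_iff] at hyo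
      omega
    obtain ⟨z, hz, hzmax⟩ := Finset.exists_max_image
      (Q.filter fun w : Fin n => (w : ℕ) / 2 ^ p.2 = (x : ℕ) / 2 ^ p.2) id
      ⟨x, Finset.mem_filter.2 ⟨hx, rfl⟩⟩
    obtain ⟨hzQ, hzx⟩ := Finset.mem_filter.1 hz
    have hzy : z < y := by
      by_contra hcon
      have := Nat.div_le_div_right (c := 2 ^ p.2) (Fin.le_def.1 (not_lt.1 hcon))
      omega
    obtain ⟨z', hz', hzmin⟩ := Finset.exists_min_image
      (Q.filter fun w => z < w) id ⟨y, Finset.mem_filter.2 ⟨hy, hzy⟩⟩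
    obtain ⟨hzQ', hzz'⟩ := Finset.mem_filter.1 hz'
    have hzx1 := div_two_pow_eq_of_le (Nat.le_succ p.2) hzx
    refine ⟨z, hzQ, ?_, z', hzQ', hzz', fun w hw hzw => hzmin w (Finset.mem_filter.2 ⟨hw, hzw⟩),
      fun he => ?_, ?_⟩
    · rw [← hxj]
      exact div_two_pow_eq_of_le (by have := hI p hpI; omega) hzx
    · exact absurd (hzmax z' (Finset.mem_filter.2 ⟨hzQ', he ▸ hzx⟩)) (not_le.2 hzz')
    · have h1 := Nat.div_le_div_right (c := 2 ^ (p.2 + 1)) (Fin.le_def.1 hzz'.le)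
      have h2 := Nat.div_le_div_right (c := 2 ^ (p.2 + 1))
        (Fin.le_def.1 (hzmin y (Finset.mem_filter.2 ⟨hy, hzy⟩)))
      simp only [id, Nat.succ_eq_add_one] at h1 h2 hzx1
      omega
  -- The successor of `z` is unique, the scale is the one where the two points first share a dyadic
  -- interval, and `z` alone determines the block.
  · rintro z - ⟨j, k⟩ ⟨-, hj, z₁, hz₁, hlt₁, hmin₁, hne₁, he₁⟩ ⟨j', k'⟩
      ⟨-, hj', z₂, hz₂, hlt₂, hmin₂, hne₂, he₂⟩
    obtain rfl : z₁ = z₂ := le_antisymm (hmin₁ _ hz₂ hlt₂) (hmin₂ _ hz₁ hlt₁)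
    have hk : k = k' := by
      rcases lt_trichotomy k k' with h | h | h
      · exact absurd (div_two_pow_eq_of_le h he₁) hne₂
      · exact h
      · exact absurd (div_two_pow_eq_of_le h he₂) hne₁
    simp only at hj hj'
    rw [hk, ← hj, ← hj']

/-- The number of dyadic scales at which `i` is one of the first two points of a block. -/
def boundaryLevel (K i : ℕ) : ℕ :=
  ((Finset.range K).filter fun r => i % 2 ^ (r + 1) < 2).card

theorem mod_two_pow_le {i r s : ℕ} (h : r ≤ s) : i % 2 ^ r ≤ i % 2 ^ s := by
  rw [← Nat.mod_mod_of_dvd i (pow_dvd_pow 2 h)]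
  exact Nat.mod_le _ _

/-- Since `i % 2 ^ (r + 1)` is monotone in `r`, the scales counted by `boundaryLevel` form an
initial segment. With `lt_boundaryLevel` this makes the level a threshold between interior and
boundary points at scale `k`. -/
theorem boundaryLevel_le {K i k : ℕ} (h : 2 ≤ i % 2 ^ (k + 1)) : boundaryLevel K i ≤ k := by
  refine (Finset.card_le_card (t := Finset.range k) fun r hr => ?_).trans_eq (Finset.card_range k)
  obtain ⟨-, hr2⟩ := Finset.mem_filter.1 hr
  rw [Finset.mem_range]
  by_contra hcon
  have := mod_two_pow_le (i := i) (show k + 1 ≤ r + 1 by omega)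
  omega

theorem lt_boundaryLevel {K i k : ℕ} (hk : k < K) (h : i % 2 ^ (k + 1) < 2) :
    k < boundaryLevel K i := by
  have : (Finset.range (k + 1)).card ≤ boundaryLevel K i := by
    refine Finset.card_le_card fun r hr => ?_
    rw [Finset.mem_range] at hr
    have := mod_two_pow_le (i := i) (show r + 1 ≤ k + 1 by omega)
    exact Finset.mem_filter.2 ⟨Finset.mem_range.2 (by omega), by omega⟩
  rwa [Finset.card_range] at this

end Dyadic

/-! ### The tilt, its affine disguise, and farness. -/

section Perturbation

open Classical in
/-- The perturbation that lowers the slope by `C` on the right halves of the dyadic intervals of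
length `2 ^ (p.2 + 1)` inside the `p.1`-th dyadic interval of length `2 ^ K`. -/
noncomputable def bend (K : ℕ) (p : ℕ × ℕ) (C : ℤ) (x : ℕ) : ℤ :=
  if x / 2 ^ K = p.1 ∧ Odd (x / 2 ^ p.2) then -C * x else 0

open Classical in
/-- A function that agrees with `bend` on `Q` if `Q` does not split the relevant dyadic intervals,
and that is affine on each of them. -/
noncomputable def bendHull {n : ℕ} (Q : Finset (Fin n)) (K : ℕ) (p : ℕ × ℕ) (C : ℤ) (x : ℕ) : ℤ :=
  if x / 2 ^ K = p.1 ∧ ∃ y ∈ Q, (y : ℕ) / 2 ^ (p.2 + 1) = x / 2 ^ (p.2 + 1) ∧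
    Odd ((y : ℕ) / 2 ^ p.2) then -C * x else 0

theorem bendHull_eq_bend {n : ℕ} {Q : Finset (Fin n)} {K : ℕ} {p : ℕ × ℕ} (C : ℤ)
    (hQ : ¬ Splits Q K p) {x : Fin n} (hx : x ∈ Q) : bendHull Q K p C x = bend K p C x := by
  rw [bendHull, bend]
  refine if_congr (and_congr_right fun hj => ⟨?_, fun h => ⟨x, hx, rfl, h⟩⟩) rfl rfl
  rintro ⟨y, hy, hyx, hodd⟩
  by_contra hcon
  exact hQ ⟨x, hx, y, hy, hj, hyx.symm, Nat.not_odd_iff_even.1 hcon, hodd⟩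

theorem abs_bendHull_le {n : ℕ} (Q : Finset (Fin n)) (K : ℕ) (p : ℕ × ℕ) {C : ℤ} (hC : 0 ≤ C)
    {x : ℕ} (hx : x < n) : |bendHull Q K p C x| ≤ C * n := by
  have h : C * (x : ℤ) ≤ C * n := mul_le_mul_of_nonneg_left (by omega) hC
  have h0 : 0 ≤ C * (x : ℤ) := by positivity
  rw [bendHull]
  split_ifs
  · rw [neg_mul, abs_neg, abs_of_nonneg h0]
    exact h
  · rw [abs_zero]
    linarith

/-- For such `i` the points `i - 2`, `i - 1`, `i` lie in one dyadic interval, where the hull is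
linear. Only the first two positions of an interval can carry a correction. -/
theorem secondDiff_bendHull {n : ℕ} (Q : Finset (Fin n)) {K : ℕ} {p : ℕ × ℕ} (hp : p.2 + 1 ≤ K)
    (C : ℤ) {i : ℕ} (hi : 2 ≤ i % 2 ^ (p.2 + 1)) : secondDiff (bendHull Q K p C) i = 0 := by
  match i, hi with
  | 0, hi => simp at hi
  | 1, hi => exact absurd (Nat.mod_le 1 (2 ^ (p.2 + 1))) (by omega)
  | i + 2, hi =>
    have key : ∀ c ≤ 2, (i + c) / 2 ^ (p.2 + 1) = (i + 2) / 2 ^ (p.2 + 1) := by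
      intro c hc
      have h1 := Nat.div_add_mod (i + 2) (2 ^ (p.2 + 1))
      have h2 := Nat.mod_lt (i + 2) (Nat.two_pow_pos (p.2 + 1))
      refine Nat.div_eq_of_lt_le ?_ ?_
      · rw [mul_comm]; omega
      · rw [add_mul, mul_comm, one_mul]; omega
    have k0 : i / 2 ^ (p.2 + 1) = (i + 2) / 2 ^ (p.2 + 1) := key 0 (by omega)
    have k1 := key 1 (by omega)
    simp only [secondDiff, bendHull, div_two_pow_eq_of_le hp k0, div_two_pow_eq_of_le hp k1, k0, k1]
    split_ifs
    · push_cast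
      ring
    · simp

/-- A perturbed function is far from convex as soon as its second differences inside the dyadic
intervals of length `2 ^ (p.2 + 1)` are nonnegative and small. -/
theorem farFromConvex_bend {n K : ℕ} {p : ℕ × ℕ} {ε : ℝ} (hp : p.2 + 1 ≤ K) (hp0 : 1 ≤ p.2)
    (hpn : (p.1 + 1) * 2 ^ K ≤ n) (hε : 4 * (ε * n) ≤ 2 ^ K) {B C : ℤ} (hB : 0 ≤ B)
    (hC : n * B < C) {a : Fin n → ℤ}
    (ha : ∀ i : Fin n, 2 ≤ (i : ℕ) % 2 ^ (p.2 + 1) → 0 ≤ a i ∧ a i ≤ B) :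
    FarFromConvex ε (fun x : Fin n => ((rampSum a x + bend K p C x : ℤ) : ℝ)) := by
  intro f hf
  obtain ⟨j, k⟩ := p
  obtain ⟨t, rfl⟩ := Nat.exists_eq_add_of_le hp
  simp only at *
  set g : Fin n → ℝ := fun x => ((rampSum a x + bend (k + 1 + t) (j, k) C x : ℤ) : ℝ) with hg
  have hblock : ∀ b ∈ Finset.Ico (j * 2 ^ t) ((j + 1) * 2 ^ t), 2 ^ k - 1 ≤
      (((Finset.univ.filter fun x : Fin n => f x ≠ g x).filter
        fun x : Fin n => (x : ℕ) / 2 ^ (k + 1) ∈ Finset.Ico (j * 2 ^ t) ((j + 1) * 2 ^ t)).filter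
        fun x : Fin n => (x : ℕ) / 2 ^ (k + 1) = b).card := by
    intro b hb
    have hb' := Finset.mem_Ico.1 hb
    have hbn : b * 2 ^ (k + 1) + 2 * 2 ^ k ≤ n := by
      refine le_trans ?_ hpn
      calc b * 2 ^ (k + 1) + 2 * 2 ^ k = (b + 1) * 2 ^ (k + 1) := by ring
        _ ≤ ((j + 1) * 2 ^ t) * 2 ^ (k + 1) := Nat.mul_le_mul_right _ hb'.2
        _ = _ := by ring
    have hbj : b / 2 ^ t = j := Nat.div_eq_of_lt_le hb'.1 hb'.2
    have hdiv : ∀ x, b * 2 ^ (k + 1) ≤ x → x < b * 2 ^ (k + 1) + 2 * 2 ^ k →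
        x / 2 ^ (k + 1) = b := by
      intro x h1 h2
      exact Nat.div_eq_of_lt_le h1 (by rw [add_mul, one_mul, pow_succ 2 k]; rw [pow_succ] at h2; omega)
    have ha' : ∀ i : Fin n, b * 2 ^ (k + 1) + 2 ≤ (i : ℕ) →
        (i : ℕ) < b * 2 ^ (k + 1) + 2 * 2 ^ k → 0 ≤ a i ∧ a i ≤ B := by
      intro i h1 h2
      refine ha i ?_
      have h3 := Nat.div_add_mod (i : ℕ) (2 ^ (k + 1))
      rw [hdiv i (by omega) h2, mul_comm] at h3
      omega
    -- The threshold is the slope of the unperturbed function on entering the interval: slopes on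
    -- the left are at least this, and those on the right at most this plus `n * B - C`, which is
    -- smaller.
    refine (le_card_ne_of_slopes (g := g) hbn hf
      ((∑ i : Fin n, if (i : ℕ) ≤ b * 2 ^ (k + 1) + 1 then a i else 0 : ℤ) : ℝ)
      ?_ ?_).trans (Finset.card_le_card fun x hx => ?_)
    · have hbend : ∀ x, b * 2 ^ (k + 1) ≤ x → x < b * 2 ^ (k + 1) + 2 ^ k →
          bend (k + 1 + t) (j, k) C x = 0 := by
        intro x h1 h2
        have : x / 2 ^ k = 2 * b := Nat.div_eq_of_lt_le (by rw [pow_succ] at h1; linarith)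
          (by rw [pow_succ] at h2; linarith)
        simp [bend, this]
      intro x y hx hxy hy
      have hxy' : (x : ℕ) < y := hxy
      have := (rampSum_slope_bounds hB ha' hx hxy (by omega)).1
      simp only [hg, hbend x hx (by omega), hbend y (by omega) hy, add_zero]
      exact_mod_cast this
    · have hbend : ∀ x, b * 2 ^ (k + 1) + 2 ^ k ≤ x → x < b * 2 ^ (k + 1) + 2 * 2 ^ k →
          bend (k + 1 + t) (j, k) C x = -C * x := by
        intro x h1 h2
        have e1 : x / 2 ^ k = 2 * b + 1 := Nat.div_eq_of_lt_le (by rw [pow_succ] at h1; linarith)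
          (by rw [pow_succ] at h2; linarith)
        have e2 : x / 2 ^ (k + 1 + t) = j := by
          rw [pow_add, ← Nat.div_div_eq_div_mul, hdiv x (by omega) h2, hbj]
        simp [bend, e1, e2]
      intro x y hx hxy hy
      have hxy' : (x : ℕ) < y := hxy
      have := (rampSum_slope_bounds hB ha' (by omega) hxy hy).2
      simp only [hg, hbend x hx (by omega), hbend y (by omega) hy]
      have hlt : (rampSum a y + -C * (y : ℕ)) - (rampSum a x + -C * (x : ℕ)) <
          (∑ i : Fin n, if (i : ℕ) ≤ b * 2 ^ (k + 1) + 1 then a i else 0)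
            * ((y : ℕ) - (x : ℕ) : ℤ) := by
        have := mul_lt_mul_of_pos_right hC (show (0 : ℤ) < (y : ℕ) - (x : ℕ) by omega)
        linarith
      exact_mod_cast hlt
    · simp only [Finset.mem_filter, Finset.mem_univ, true_and] at hx ⊢
      have := hdiv x hx.2.1 hx.2.2
      exact ⟨⟨hx.1, by rw [this]; exact hb⟩, this⟩
  have hcard := Finset.mul_card_image_le_card_of_maps_to
    (fun x hx => (Finset.mem_filter.1 hx).2) _ hblock
  have hle := hcard.trans (Finset.card_le_card (Finset.filter_subset _ _))
  have hIco : (Finset.Ico (j * 2 ^ t) ((j + 1) * 2 ^ t)).card = 2 ^ t := by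
    rw [Nat.card_Ico, add_mul, one_mul, Nat.add_sub_cancel_left]
  rw [hIco] at hle
  have hk2 : 2 ≤ 2 ^ k := by
    calc 2 = 2 ^ 1 := rfl
      _ ≤ 2 ^ k := Nat.pow_le_pow_right (by norm_num) hp0
  -- Here `k ≥ 1` is essential: at scale `0` the bound `2 ^ k - 1` is zero.
  have h4 : 2 ^ (k + 1 + t) ≤ 4 * ((2 ^ k - 1) * 2 ^ t) := by
    calc 2 ^ (k + 1 + t) = (2 * 2 ^ k) * 2 ^ t := by ring
      _ ≤ (4 * (2 ^ k - 1)) * 2 ^ t := Nat.mul_le_mul_right _ (by omega)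
      _ = _ := by ring
  have h5 := h4.trans (Nat.mul_le_mul_left 4 hle)
  have h6 : (2 : ℝ) ^ (k + 1 + t)
      ≤ 4 * ((Finset.univ.filter fun x : Fin n => f x ≠ g x).card : ℝ) := by
    exact_mod_cast h5
  change ε * (n : ℝ) ≤ ((Finset.univ.filter fun x : Fin n => f x ≠ g x).card : ℝ)
  linarith

end Perturbation

/-! ### Comparing accepted convex inputs with accepted perturbed ones. -/

section Counting

/-- The integer points of the box with sides `[-β i, N i + β i)`. -/
noncomputable def integerBox {n : ℕ} (N β : Fin n → ℤ) : Finset (Fin n → ℤ) :=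
  Fintype.piFinset fun i => Finset.Ico (-β i) (N i + β i)

theorem mem_integerBox {n : ℕ} {N β a : Fin n → ℤ} :
    a ∈ integerBox N β ↔ ∀ i, -β i ≤ a i ∧ a i < N i + β i := by
  simp [integerBox]

theorem card_integerBox {n : ℕ} {N β : Fin n → ℤ} (hN : ∀ i, 0 ≤ N i) (hβ : ∀ i, 0 ≤ β i) :
    ((integerBox N β).card : ℝ) = ∏ i, ((N i : ℝ) + 2 * β i) := by
  rw [integerBox, Fintype.card_piFinset, Nat.cast_prod]
  refine Finset.prod_congr rfl fun i _ => ?_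
  rw [Int.card_Ico]
  have h : ((N i + β i - -β i).toNat : ℤ) = N i + 2 * β i := by
    rw [Int.toNat_of_nonneg (by have := hN i; have := hβ i; omega)]
    ring
  exact_mod_cast congrArg (Int.cast : ℤ → ℝ) h

/-- Each side grows by a factor at most `1 + l / n ≤ exp (l / n)`, and there are `n` sides. -/
theorem card_integerBox_le {n : ℕ} (hn : 0 < n) {N β : Fin n → ℤ} (hN : ∀ i, 0 ≤ N i)
    (hβ : ∀ i, 0 ≤ β i) {l : ℝ} (h : ∀ i, 2 * (β i : ℝ) * n ≤ N i * l) :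
    ((integerBox N β).card : ℝ) ≤ Real.exp l * (integerBox N 0).card := by
  have hn' : (0 : ℝ) < n := by exact_mod_cast hn
  rw [card_integerBox hN hβ, card_integerBox (β := 0) hN fun _ => le_rfl]
  calc ∏ i, ((N i : ℝ) + 2 * β i) ≤ ∏ i : Fin n, (Real.exp (l / n) * (N i : ℝ)) := by
        refine Finset.prod_le_prod (fun i _ => ?_) fun i _ => ?_
        · have h1 : (0 : ℝ) ≤ N i := by exact_mod_cast hN i
          have h2 : (0 : ℝ) ≤ β i := by exact_mod_cast hβ i
          linarith
        · have h1 : (0 : ℝ) ≤ N i := by exact_mod_cast hN i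
          have h2 : 2 * (β i : ℝ) ≤ N i * (l / n) := by
            rw [← mul_div_assoc, le_div_iff₀ hn']
            exact h i
          have h3 := mul_le_mul_of_nonneg_right (Real.add_one_le_exp (l / n)) h1
          linarith
    _ = Real.exp l * ∏ i, ((N i : ℝ) + 2 * ((0 : Fin n → ℤ) i : ℤ)) := by
        rw [Finset.prod_mul_distrib, Finset.prod_const, Finset.card_univ, Fintype.card_fin,
          ← Real.exp_nat_mul, mul_div_cancel₀ _ hn'.ne']
        simp

open Classical in
/-- A decision tree accepts the perturbed inputs at least as often as the unperturbed ones, up to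
the inputs on which its queries split the relevant dyadic intervals. -/
theorem card_accept_le {n K : ℕ} {p : ℕ × ℕ} (hp : p.2 + 1 ≤ K) {C : ℤ} (hC : 0 ≤ C)
    {N β : Fin n → ℤ} (hβ : ∀ i, 0 ≤ β i)
    (hβC : ∀ i : Fin n, (i : ℕ) % 2 ^ (p.2 + 1) < 2 → 4 * (C * n) ≤ β i)
    (t : DecisionTree (Fin n)) :
    ((integerBox N 0).filter fun a => t.output (fun x => (rampSum a x : ℝ)) = true).card ≤
      ((integerBox N β).filter fun a =>
        t.output (fun x : Fin n => ((rampSum a x + bend K p C x : ℤ) : ℝ)) = true).card +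
      ((integerBox N 0).filter fun a =>
        Splits (t.queried fun x => (rampSum a x : ℝ)) K p).card := by
  rw [← Finset.card_filter_add_card_filter_not
    (s := (integerBox N 0).filter fun a => t.output (fun x => (rampSum a x : ℝ)) = true)
    (fun a => ¬ Splits (t.queried fun x => (rampSum a x : ℝ)) K p)]
  refine Nat.add_le_add ?_ ?_
  · set b : (Fin n → ℤ) → Fin n → ℤ := fun a i =>
      secondDiff (bendHull (t.queried fun x => (rampSum a x : ℝ)) K p C) i with hb
    have hval : ∀ a, ¬ Splits (t.queried fun x => (rampSum a x : ℝ)) K p →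
        ∀ x ∈ t.queried (fun x => (rampSum a x : ℝ)),
          ((rampSum (a - b a) x + bend K p C x : ℤ) : ℝ) = (rampSum a x : ℝ) := by
      intro a ha x hx
      rw [rampSum_sub, hb, rampSum_secondDiff, bendHull_eq_bend C ha hx, sub_add_cancel]
    -- The correction `b a` depends on `a` only through the queried set. The tree queries the same
    -- points on the perturbed image, so the image determines that set, hence `b a`, hence `a`.
    refine Finset.card_le_card_of_injOn (fun a => a - b a) ?_ ?_
    · intro a ha
      simp only [Finset.coe_filter, Set.mem_ofPred_eq, Finset.mem_filter] at ha ⊢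
      obtain ⟨⟨ha1, ha2⟩, ha3⟩ := ha
      refine ⟨mem_integerBox.2 fun i => ?_, ?_⟩
      · have h1 := mem_integerBox.1 ha1 i
        simp only [Pi.zero_apply, neg_zero, add_zero] at h1
        have h2 : |b a i| ≤ β i := by
          rcases lt_or_ge ((i : ℕ) % 2 ^ (p.2 + 1)) 2 with hi | hi
          · exact (abs_secondDiff_le (fun x hx => abs_bendHull_le _ K p hC hx) i.2).trans
              (hβC i hi)
          · rw [hb]
            simp only [secondDiff_bendHull _ hp C hi, abs_zero]
            exact hβ i
        have h3 := abs_le.1 h2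
        rw [Pi.sub_apply]
        omega
      · rw [← ha2]
        exact (t.queried_output_congr (hval a ha3)).2
    · intro a ha a' ha' haa
      simp only [Finset.coe_filter, Set.mem_ofPred_eq, Finset.mem_filter] at ha ha' haa
      have h1 := (t.queried_output_congr (hval a ha.2)).1
      have h2 := (t.queried_output_congr (hval a' ha'.2)).1
      rw [haa, h2] at h1
      have h3 : b a' = b a := by simp only [hb, h1]
      rw [h3] at haa
      exact sub_left_injective haa
  · refine Finset.card_le_card fun a ha => ?_
    simp only [Finset.mem_filter, not_not] at ha ⊢
    exact ⟨ha.1.1, ha.2⟩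

-- Sum over `p` and exchange the order of counting: each input `a` yields at most `q` queried
-- points, which split at most `q` pairs.
open Classical in
theorem card_mul_card_accept_le {n K : ℕ} {I : Finset (ℕ × ℕ)} (hI : ∀ p ∈ I, p.2 + 1 ≤ K)
    {C : ℕ × ℕ → ℤ} (hC : ∀ p, 0 ≤ C p) {N : Fin n → ℤ} {β : ℕ × ℕ → Fin n → ℤ}
    (hβ : ∀ p i, 0 ≤ β p i)
    (hβC : ∀ p, ∀ i : Fin n, (i : ℕ) % 2 ^ (p.2 + 1) < 2 → 4 * (C p * n) ≤ β p i)
    (t : DecisionTree (Fin n)) {q : ℕ}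
    (hq : ∀ a : Fin n → ℤ, t.numQueries (fun x => (rampSum a x : ℝ)) ≤ q) :
    I.card *
        ((integerBox N 0).filter fun a => t.output (fun x => (rampSum a x : ℝ)) = true).card ≤
      ∑ p ∈ I, ((integerBox N (β p)).filter fun a =>
        t.output (fun x : Fin n => ((rampSum a x + bend K p (C p) x : ℤ) : ℝ)) = true).card +
      q * (integerBox N 0).card := by
  have h1 := Finset.sum_le_sum fun p hp =>
    card_accept_le (N := N) (hI p hp) (hC p) (hβ p) (hβC p) t
  rw [Finset.sum_const, smul_eq_mul, Finset.sum_add_distrib] at h1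
  refine h1.trans (Nat.add_le_add_left ?_ _)
  simp only [Finset.card_filter]
  rw [Finset.sum_comm, mul_comm, ← smul_eq_mul]
  refine Finset.sum_le_card_nsmul _ _ _ fun a _ => ?_
  rw [← Finset.card_filter]
  exact (card_filter_splits_le _ K I hI).trans ((t.card_queried_le _).trans (hq a))

end Counting

/-! ### From counting to the query bound. -/

section Testers

variable {n : ℕ} (T : RandomizedQueryAlgorithm.{u} (Fin n))

theorem RandomizedQueryAlgorithm.probOutput_false {X : Type} (T : RandomizedQueryAlgorithm.{u} X)
    (f : X → ℝ) : T.probOutput f false = 1 - T.probOutput f true := by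
  have : {ω | (T.tree ω).output f = false} = {ω | (T.tree ω).output f = true}ᶜ := by
    ext ω
    simp
  rw [probOutput, probOutput, this, MeasureTheory.probReal_compl_eq_one_sub
    (T.measurableSet_accept f)]

/-- The expected number of accepted inputs from a finite family. -/
theorem RandomizedQueryAlgorithm.integral_card_accept {X ι : Type}
    (T : RandomizedQueryAlgorithm.{u} X) (F : ι → X → ℝ) (s : Finset ι) :
    MeasureTheory.Integrable
        (fun ω => ((s.filter fun a => (T.tree ω).output (F a) = true).card : ℝ)) T.μ ∧
      ∫ ω, ((s.filter fun a => (T.tree ω).output (F a) = true).card : ℝ) ∂T.μ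
        = ∑ a ∈ s, T.probOutput (F a) true := by
  have h : ∀ ω, ((s.filter fun a => (T.tree ω).output (F a) = true).card : ℝ)
      = ∑ a ∈ s, Set.indicator {ω | (T.tree ω).output (F a) = true} (1 : T.Ω → ℝ) ω := by
    intro ω
    rw [Finset.card_filter, Nat.cast_sum]
    exact Finset.sum_congr rfl fun a _ => by simp [Set.indicator_apply]
  have hint : ∀ a ∈ s, MeasureTheory.Integrable
      (Set.indicator {ω | (T.tree ω).output (F a) = true} (1 : T.Ω → ℝ)) T.μ := fun a _ =>
    (MeasureTheory.integrable_const (1 : ℝ)).indicator (T.measurableSet_accept (F a))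
  simp only [h]
  refine ⟨MeasureTheory.integrable_finsetSum _ hint, ?_⟩
  rw [MeasureTheory.integral_finsetSum _ hint]
  refine Finset.sum_congr rfl fun a _ => ?_
  rw [MeasureTheory.integral_indicator_one (T.measurableSet_accept (F a))]
  rfl

/-- A tester whose inputs include all integer-valued functions makes at least a constant number of
queries for every pair of a dyadic interval of length `2 ^ K` and a scale inside it. -/
theorem mul_card_le_of_isConvexityTester {V : Set ℝ} (hV : ∀ z : ℤ, (z : ℝ) ∈ V) {ε δ : ℝ}
    (hδ0 : 0 < δ) (hδ : δ < 1 / 2) (hn : 0 < n) {K q : ℕ} (hε : 4 * (ε * n) ≤ 2 ^ K)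
    {I : Finset (ℕ × ℕ)}
    (hI : ∀ p ∈ I, (p.1 + 1) * 2 ^ K ≤ n ∧ 1 ≤ p.2 ∧ p.2 + 1 ≤ K)
    (hT : T.IsConvexityTester V ε δ) (hq : T.QueryComplexityLE V q) :
    (1 / 2 - δ) * I.card ≤ q := by
  have hn' : (0 : ℝ) < n := by exact_mod_cast hn
  have hr : 1 < 1 / (2 * δ) := by
    rw [lt_div_iff₀ (by linarith)]
    linarith
  have hl := Real.log_pos hr
  have hexp : Real.exp (Real.log (1 / (2 * δ))) = 1 / (2 * δ) := Real.exp_log (by linarith)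
  set l := Real.log (1 / (2 * δ))
  -- With `β = 4 * C * n` and `C = n * W ^ k`, the condition `2 * β * n ≤ N * l` of
  -- `card_integerBox_le` reads `8 * n ^ 3 * W ^ k ≤ N * l`, and at boundary points `N ≥ W ^ (k +
  -- 1)`.
  obtain ⟨W, hW⟩ := exists_nat_ge (8 * (n : ℝ) ^ 3 / l)
  have hWpos : 0 < W := by
    have : (0 : ℝ) < 8 * (n : ℝ) ^ 3 / l := by positivity
    exact_mod_cast this.trans_le hW
  rw [div_le_iff₀ hl] at hW
  have hWpow : ∀ e, (0 : ℤ) < (W : ℤ) ^ e := fun e => by positivity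
  set N : Fin n → ℤ := fun i => (W : ℤ) ^ boundaryLevel K i with hN
  set C : ℕ × ℕ → ℤ := fun p => n * (W : ℤ) ^ p.2 with hC
  set β : ℕ × ℕ → Fin n → ℤ := fun p i =>
    if (i : ℕ) % 2 ^ (p.2 + 1) < 2 then 4 * (C p * n) else 0 with hβ
  have hN0 : ∀ i, 0 ≤ N i := fun i => (hWpow _).le
  have hC0 : ∀ p, 0 ≤ C p := fun p => by positivity
  have hβ0 : ∀ p i, 0 ≤ β p i := by
    intro p i
    have := hC0 p
    simp only [hβ]
    split_ifs
    · positivity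
    · exact le_rfl
  have hratio : ∀ p ∈ I, ((integerBox N (β p)).card : ℝ) * δ ≤ 1 / 2 * (integerBox N 0).card := by
    intro p hp
    have := card_integerBox_le hn hN0 (hβ0 p) (l := l) (by
      intro i
      simp only [hβ]
      split_ifs with hi
      · have hlev := lt_boundaryLevel (K := K) (show p.2 < K by have := hI p hp; omega) hi
        have hW1 : (W : ℝ) ^ (p.2 + 1) ≤ (W : ℝ) ^ boundaryLevel K i :=
          pow_le_pow_right₀ (by exact_mod_cast hWpos) hlev
        simp only [hC, hN]
        push_cast
        calc 2 * (4 * ((n : ℝ) * (W : ℝ) ^ p.2 * n)) * n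
            = (W : ℝ) ^ p.2 * (8 * (n : ℝ) ^ 3) := by ring
          _ ≤ (W : ℝ) ^ p.2 * (W * l) := mul_le_mul_of_nonneg_left hW (by positivity)
          _ = (W : ℝ) ^ (p.2 + 1) * l := by ring
          _ ≤ _ := mul_le_mul_of_nonneg_right hW1 hl.le
      · have : (0 : ℝ) ≤ N i := by exact_mod_cast hN0 i
        simp only [Int.cast_zero, mul_zero, zero_mul]
        positivity)
    rw [hexp] at this
    calc _ ≤ 1 / (2 * δ) * (integerBox N 0).card * δ := mul_le_mul_of_nonneg_right this hδ0.le
      _ = _ := by field_simp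
  have hfar : ∀ p ∈ I, ∀ a ∈ integerBox N (β p),
      T.probOutput (fun x : Fin n => ((rampSum a x + bend K p (C p) x : ℤ) : ℝ)) true ≤ δ := by
    intro p hp a ha
    obtain ⟨hp1, hp2, hp3⟩ := hI p hp
    have h1 : FarFromConvex ε (fun x : Fin n => ((rampSum a x + bend K p (C p) x : ℤ) : ℝ)) := by
      refine farFromConvex_bend hp3 hp2 hp1 hε (B := (W : ℤ) ^ p.2 - 1) ?_ ?_ ?_
      · have := hWpow p.2
        omega
      · have : (0 : ℤ) < n := by exact_mod_cast hn
        simp only [hC]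
        linarith
      · intro i hi
        have h2 := mem_integerBox.1 ha i
        simp only [hβ, if_neg (not_lt.2 hi), neg_zero, add_zero] at h2
        have h3 : N i ≤ (W : ℤ) ^ p.2 :=
          pow_le_pow_right₀ (by exact_mod_cast hWpos) (boundaryLevel_le hi)
        omega
    have h2 := (hT _ fun x => hV _).2 h1
    rw [T.probOutput_false] at h2
    linarith
  have hconv : ∀ a ∈ integerBox N 0,
      1 - δ ≤ T.probOutput (fun x : Fin n => (rampSum a x : ℝ)) true := by
    intro a ha
    refine (hT _ fun x => hV _).1 (lineConvex_rampSum fun i => ?_)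
    simpa using (mem_integerBox.1 ha i).1
  have hA : (0 : ℝ) < (integerBox N 0).card := by
    rw [card_integerBox (β := 0) hN0 fun _ => le_rfl]
    refine Finset.prod_pos fun i _ => ?_
    have h1 : 0 < N i := hWpow _
    have : (0 : ℝ) < N i := by exact_mod_cast h1
    simpa using this
  have hint0 := T.integral_card_accept (fun a x => (rampSum a x : ℝ)) (integerBox N 0)
  have hint : ∀ p ∈ I, _ := fun p _ => T.integral_card_accept
    (fun a (x : Fin n) => ((rampSum a x + bend K p (C p) x : ℤ) : ℝ)) (integerBox N (β p))
  -- Averaging over the coin tosses: with `A` the size of the unwidened box, the left side becomes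
  -- at least `|I| * (1 - δ) * A`, the right at most `|I| * A / 2 + q * A`.
  have hmono := MeasureTheory.integral_mono (μ := T.μ) (hint0.1.const_mul (I.card : ℝ))
    ((MeasureTheory.integrable_finsetSum I fun p hp => (hint p hp).1).add
      (MeasureTheory.integrable_const ((q : ℝ) * (integerBox N 0).card)))
    (fun ω => by
      have := card_mul_card_accept_le (N := N) (fun p hp => (hI p hp).2.2) hC0 hβ0
        (fun p i hi => by simp only [hβ, if_pos hi]; exact le_rfl) (T.tree ω)
        (fun a => hq _ (fun x => hV _) ω)
      simp only [Pi.add_apply]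
      exact_mod_cast this)
  simp only [Pi.add_apply] at hmono
  rw [MeasureTheory.integral_const_mul, hint0.2, MeasureTheory.integral_add
    (MeasureTheory.integrable_finsetSum I fun p hp => (hint p hp).1)
    (MeasureTheory.integrable_const _), MeasureTheory.integral_finsetSum I
    fun p hp => (hint p hp).1, Finset.sum_congr rfl fun p hp => (hint p hp).2] at hmono
  simp only [MeasureTheory.integral_const, MeasureTheory.probReal_univ, one_smul] at hmono
  have hlow := Finset.card_nsmul_le_sum _ _ _ hconv
  have hup : ∑ p ∈ I, ∑ a ∈ integerBox N (β p),
      T.probOutput (fun x : Fin n => ((rampSum a x + bend K p (C p) x : ℤ) : ℝ)) true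
        ≤ I.card • (1 / 2 * ((integerBox N 0).card : ℝ)) := by
    refine Finset.sum_le_card_nsmul _ _ _ fun p hp => ?_
    refine (Finset.sum_le_card_nsmul _ _ _ (hfar p hp)).trans ?_
    rw [nsmul_eq_mul]
    exact hratio p hp
  rw [nsmul_eq_mul] at hlow hup
  have hlow' := mul_le_mul_of_nonneg_left hlow (Nat.cast_nonneg (α := ℝ) I.card)
  refine le_of_mul_le_mul_right ?_ hA
  linarith

theorem log_div_le_of_isConvexityTester {V : Set ℝ} (hV : ∀ z : ℤ, (z : ℝ) ∈ V) {ε δ : ℝ}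
    (hδ0 : 0 < δ) (hδ : δ < 1 / 2) (hn : 0 < n) (hε1 : 1 / (n : ℝ) ≤ ε) (hε2 : ε ≤ 1 / 9) {q : ℕ}
    (hT : T.IsConvexityTester V ε δ) (hq : T.QueryComplexityLE V q) :
    (1 / 2 - δ) / 16 * (Real.log (ε * n) / ε) ≤ q := by
  have hn' : (0 : ℝ) < n := by exact_mod_cast hn
  have hεn : 1 ≤ ε * n := by rwa [div_le_iff₀ hn'] at hε1
  have hε0 : 0 < ε := lt_of_lt_of_le (by positivity) hε1
  -- The block length `2 ^ (m + 1)` lies in `(4 * ε * n, 8 * ε * n]`: long enough for farness, and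
  -- at most `n` because `ε ≤ 1/9`, so at least one block fits. The scales used are `1, …, m`.
  obtain ⟨m, hm1, hm2⟩ := exists_nat_pow_near (show (1 : ℝ) ≤ 4 * (ε * n) by linarith)
    (show (1 : ℝ) < 2 by norm_num)
  have hK : (2 : ℝ) ^ (m + 1) ≤ 8 * (ε * n) := by
    rw [pow_succ]
    linarith
  have hKn : (2 : ℝ) ^ (m + 1) ≤ n := by
    have := mul_le_mul_of_nonneg_right hε2 hn'.le
    linarith
  set b : ℕ := n / 2 ^ (m + 1) with hb
  have hI := mul_card_le_of_isConvexityTester T hV hδ0 hδ hn (K := m + 1) hm2.le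
    (I := Finset.range b ×ˢ Finset.Icc 1 m) (by
      intro p hp
      simp only [Finset.mem_product, Finset.mem_range, Finset.mem_Icc] at hp
      refine ⟨?_, by omega, by omega⟩
      exact (Nat.mul_le_mul_right _ hp.1).trans (Nat.div_mul_le_self _ _)) hT hq
  rw [Finset.card_product, Finset.card_range, Nat.card_Icc, Nat.add_sub_cancel, Nat.cast_mul] at hI
  refine le_trans ?_ hI
  have hb1 : 1 ≤ b := (Nat.one_le_div_iff (Nat.two_pow_pos _)).2 (by exact_mod_cast hKn)
  have hb2 : (n : ℝ) < (b + 1) * 2 ^ (m + 1) := by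
    have : n < (b + 1) * 2 ^ (m + 1) :=
      (Nat.div_lt_iff_lt_mul (Nat.two_pow_pos _)).1 (Nat.lt_succ_self _)
    exact_mod_cast this
  -- From `b ≥ 1`, `n < (b + 1) * 2 ^ (m + 1) ≤ 2 * b * (8 * ε * n)`; this is the origin of the
  -- constant `16`.
  have hb3 : 1 / (16 * ε) ≤ b := by
    rw [div_le_iff₀ (by linarith)]
    have h1 : (1 : ℝ) ≤ b := by exact_mod_cast hb1
    have h2 : ((b : ℝ) + 1) * 2 ^ (m + 1) ≤ (2 * b) * (8 * (ε * n)) :=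
      mul_le_mul (by linarith) hK (by positivity) (by positivity)
    refine le_of_mul_le_mul_right ?_ hn'
    linarith
  have hlog : Real.log (ε * n) ≤ m := by
    have h1 : ε * n ≤ 2 ^ m := by
      rw [pow_succ] at hm2
      linarith
    calc Real.log (ε * n) ≤ Real.log (2 ^ m) := Real.log_le_log (by linarith) h1
      _ = m * Real.log 2 := Real.log_pow _ _
      _ ≤ m * 1 := mul_le_mul_of_nonneg_left (by linarith [Real.log_two_lt_d9]) (Nat.cast_nonneg m)
      _ = m := mul_one _
  calc (1 / 2 - δ) / 16 * (Real.log (ε * n) / ε)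
      = (1 / 2 - δ) * (1 / (16 * ε) * Real.log (ε * n)) := by field_simp
    _ ≤ (1 / 2 - δ) * (b * m) := by
        refine mul_le_mul_of_nonneg_left ?_ (by linarith)
        exact mul_le_mul hb3 hlog (Real.log_nonneg hεn) (Nat.cast_nonneg b)

end Testers

theorem theorem1p3 (δ : ℝ) (hδ0 : 0 < δ) (hδ : δ < 1 / 2) :
    ∃ c : ℝ, 0 < c ∧
      ∀ (n : ℕ) (ε : ℝ), 0 < n → 1 / (n : ℝ) ≤ ε → ε ≤ 1 / 9 →
        ∀ (T : RandomizedQueryAlgorithm.{u} (Fin n)) (q : ℕ),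
          (T.IsConvexityTester Set.univ ε δ → T.QueryComplexityLE Set.univ q →
            c * (Real.log (ε * (n : ℝ)) / ε) ≤ (q : ℝ)) ∧
          (T.IsConvexityTester (Set.range ((↑) : ℤ → ℝ)) ε δ →
            T.QueryComplexityLE (Set.range ((↑) : ℤ → ℝ)) q →
              c * (Real.log (ε * (n : ℝ)) / ε) ≤ (q : ℝ)) := by
  exact ⟨(1 / 2 - δ) / 16, by linarith, fun n ε hn hε1 hε2 T q =>
    ⟨log_div_le_of_isConvexityTester T (fun _ => Set.mem_univ _) hδ0 hδ hn hε1 hε2,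
      log_div_le_of_isConvexityTester T (fun z => Set.mem_range_self z) hδ0 hδ hn hε1 hε2⟩⟩
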